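/- Let $q$ be a prime power, let $N(x)=x^{q^2+q+1}$ be the norm from $\mathrm{GF}(q^3)$ to $\mathrm{GF}(q)$, and identify the 6-dimensional $\mathrm{GF}(q)$-vector space underlying $\mathrm{PG}(5,q)$ with $\mathrm{GF}(q^3)^2$ by some $\mathrm{GF}(q)$-linear isomorphism. The $q^3+1$ one-dimensional $\mathrm{GF}(q^3)$-subspaces $\pi_x=\{(y,xy)\}$ $(x\in\mathrm{GF}(q^3))$ and $\pi_\infty=\{(0,y)\}$ are then the planes of a regular 2-spread of $\mathrm{PG}(5,q)$. A cover of the circle geometry $CG(3,q)$ is a set of the form $\{x\in\mathrm{GF}(q^3): N(x-a)=f\}$ with $a\in\mathrm{GF}(q^3)$, or $\{x\in\mathrm{GF}(q^3)\cup\{\infty\}: N\left(\frac{x-a}{x-b}\right)=f\}$ with $a\ne b\in\mathrm{GF}(q^3)$, where $f\in\mathrm{GF}(q)\setminus\{0\}$. An André hyper-regulus in $\mathrm{PG}(5,q)$ is a set $\mathbb X=\{\pi_x: x\in C\}$ for such an identification and a cover $C$. A switching set of $\mathbb X$ is a set of $q^2+q+1$ mutually disjoint planes, each of which meets every plane of $\mathbb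 X$ in exactly one point. **Theorem.** Let $\mathbb X$ be an André hyper-regulus in $\mathrm{PG}(5,q)$. Then $\mathbb X$ consists of $q^2+q+1$ mutually disjoint planes and has exactly two switching sets $\mathbb Y$, $\mathbb Z$, and every plane of $\mathbb Y$ meets every plane of $\mathbb Z$ in exactly one point. Exactly $2(q^2+q+1)$ planes of $\mathrm{PG}(5,q)$ meet every plane of $\mathbb X$ in exactly one point, namely the planes of $\mathbb Y$ and $\mathbb Z$; these are also the only planes that have a non-empty intersection with every plane of $\mathbb X$. -/

import Mathlib

open Module

/-- The set of points `x` of the projective line `L ∪ {∞}` with `N (x - a) = f`,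
where `N` is the norm from `L` to `K`. -/
def coverI (K : Type*) {L : Type*} [Field K] [Field L] [Algebra K L]
    (a : L) (f : K) : Set (OnePoint L) :=
  {z | ∃ x : L, z = (x : OnePoint L) ∧ Algebra.norm K (x - a) = f}

/-- The set of points `x` of the projective line `L ∪ {∞}` with `N ((x - a) / (x - b)) = f`,
where `N` is the norm from `L` to `K`. The fraction takes the value `1` at `x = ∞`,
and the value `∞` at `x = b`, so that `b` is excluded. -/
def coverII (K : Type*) {L : Type*} [Field K] [Field L] [Algebra K L]
    (a b : L) (f : K) : Set (OnePoint L) :=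
  {z | (∃ x : L, z = (x : OnePoint L) ∧ x ≠ b ∧ Algebra.norm K ((x - a) / (x - b)) = f) ∨
    (z = OnePoint.infty ∧ f = 1)}

/-- The covers of the circle geometry `CG(3,q)`, as sets of points of the projective line over
the cubic extension `L` of `K = GF(q)`. -/
def IsCover (K : Type*) {L : Type*} [Field K] [Field L] [Algebra K L]
    (C : Set (OnePoint L)) : Prop :=
  (∃ (a : L) (f : K), f ≠ 0 ∧ C = coverI K a f) ∨
  (∃ (a b : L) (f : K), a ≠ b ∧ f ≠ 0 ∧ C = coverII K a b f)

section Geometry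

variable {K L V : Type*} [Field K] [Field L] [Algebra K L] [AddCommGroup V] [Module K V]

/-- The one-dimensional `L`-subspace of `L × L` of slope `z`, seen as a `K`-subspace:
`{(y, x y) | y ∈ L}` for `z = x ∈ L`, and `{(0, y) | y ∈ L}` for `z = ∞`. -/
def lineOfSlope (K : Type*) {L : Type*} [Field K] [Field L] [Algebra K L] :
    OnePoint L → Submodule K (L × L)
  | Option.none => LinearMap.range (LinearMap.inr K L L)
  | Option.some x => LinearMap.range (LinearMap.prod LinearMap.id (LinearMap.mulLeft K x))

/-- Given an identification `φ` of the 6-dimensional space `V` with `L × L`, the elements of the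
corresponding regular (Desarguesian) spread are the `spreadPlane φ z`, with `z` running through
the points of the projective line over `L`. -/
def spreadPlane (φ : (L × L) ≃ₗ[K] V) (z : OnePoint L) : Submodule K V :=
  (lineOfSlope K z).map φ.toLinearMap

/-- An André hyper-regulus: the planes of a regular 2-spread that correspond to the points of
a cover of the circle geometry. -/
def IsAndreHyperRegulus (L : Type*) [Field L] [Algebra K L] (X : Set (Submodule K V)) : Prop :=
  ∃ (φ : (L × L) ≃ₗ[K] V) (C : Set (OnePoint L)), IsCover K C ∧ X = spreadPlane φ '' C

/-- A (projective) plane of the projective space of `V` is a subspace of vector dimension 3. -/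
def IsPlane (P : Submodule K V) : Prop := finrank K P = 3

/-- Two subspaces meet in exactly one projective point. -/
def MeetInPoint (P Q : Submodule K V) : Prop := finrank K (P ⊓ Q : Submodule K V) = 1

/-- A set of `q² + q + 1` mutually disjoint planes, where `q` is the order of `K`. -/
structure IsDisjointPlaneFamily (T : Set (Submodule K V)) : Prop where
  isPlane : ∀ P ∈ T, IsPlane P
  disjoint : ∀ P ∈ T, ∀ Q ∈ T, P ≠ Q → P ⊓ Q = ⊥
  ncard_eq : T.ncard = Nat.card K ^ 2 + Nat.card K + 1

/-- `T` is a switching set of `X`: a set of `q² + q + 1` mutually disjoint planes, each of which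
meets every plane of `X` in exactly one point. -/
structure IsSwitchingSet (X T : Set (Submodule K V)) : Prop where
  family : IsDisjointPlaneFamily T
  meet : ∀ P ∈ T, ∀ Q ∈ X, MeetInPoint P Q

end Geometry

/-! A projectivity over `L` carries any cover to the set of elements of norm one, so `X` may be
taken as the planes `{(y, u y)}` with `N(u) = 1`. For `σ` in the Galois group, which has order 3,
the planes `{(y, c σ(y))}` with `N(c) = 1` form a disjoint family: `σ = 1` gives `X`, the two other
automorphisms give `Y` and `Z`. By Hilbert 90, planes from different families meet in exactly one
point (`finrank_twistedLine_inf_twistedLine`).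

Conversely, let a plane `P` meet every plane of `X`. It has only `q² + q + 1` points, so these lie
one on each plane of `X`, and `P` is the graph of a `K`-linear map `M` for which `M y / y` takes
every value of norm one exactly `q - 1` times. The map `y ↦ y ^ q` has the same property, so the
power sums of `M y / y` equal those of `y ^ (q - 1)`, and these vanish for exponents 1 and `q + 1`.
Writing `M y = a y + b y ^ q + c y ^ (q²)`, the first sum gives `a = 0`, the second `b c ^ q = 0`.
Hence `M` is a multiple of a nontrivial automorphism (`exists_eq_twistedLine_of_forall_inf_ne_bot`).
-/

/-! ### Norms, Hilbert 90 and linearized polynomials over finite fields. -/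

section FiniteFieldExtension

variable {K L : Type*} [Field K] [Field L] [Finite L] [Algebra K L]

theorem finite_of_finite_extension (K L : Type*) [Field K] [Field L] [Finite L] [Algebra K L] :
    Finite K :=
  Finite.of_injective _ (algebraMap K L).injective

theorem card_ker_unitsMap_norm_mul (K L : Type*) [Field K] [Field L] [Finite L] [Algebra K L] :
    Nat.card (Units.map (Algebra.norm K (S := L))).ker * Nat.card Kˣ = Nat.card Lˣ := by
  rw [← Subgroup.card_mul_index (Units.map (Algebra.norm K (S := L))).ker, Subgroup.index_ker,
    MonoidHom.range_eq_top.mpr (FiniteField.unitsMap_norm_surjective K L), Subgroup.card_top]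

theorem card_norm_eq_one [Finite K] (hL : finrank K L = 3) :
    Nat.card {u : L // Algebra.norm K u = 1} = Nat.card K ^ 2 + Nat.card K + 1 := by
  have h := card_ker_unitsMap_norm_mul K L
  have e : (Units.map (Algebra.norm K (S := L))).ker ≃ {u : L // Algebra.norm K u = 1} :=
    { toFun := fun u => ⟨u.1, congrArg Units.val (MonoidHom.mem_ker.mp u.2)⟩
      invFun := fun u => ⟨Units.mk0 u.1 (by
        rintro h0
        have := u.2
        simp [h0] at this), MonoidHom.mem_ker.mpr (Units.ext u.2)⟩
      left_inv := fun u => by ext; simp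
      right_inv := fun u => by ext; simp }
  rw [Nat.card_congr e, Nat.card_units, Nat.card_units,
    Module.natCard_eq_pow_finrank (K := K) (V := L), hL] at h
  -- Putting `q = r + 2` removes truncated subtraction from `q³ - 1 = (q² + q + 1)(q - 1)`.
  obtain ⟨r, hr⟩ : ∃ r, Nat.card K = r + 2 := ⟨Nat.card K - 2, by
    have := Finite.one_lt_card (α := K); omega⟩
  rw [hr] at h ⊢
  have h2 : (r + 2) ^ 3 - 1 = ((r + 2) ^ 2 + (r + 2) + 1) * (r + 1) := by
    have : (r + 2) ^ 3 = ((r + 2) ^ 2 + (r + 2) + 1) * (r + 1) + 1 := by ring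
    omega
  rw [h2] at h
  exact Nat.eq_of_mul_eq_mul_right (by omega) h

/-- The Galois group has prime order, so `σ` generates it and the fixed field of `σ` is already `K`.
-/
theorem mem_range_algebraMap_of_fixed (hL : (finrank K L).Prime) {σ : Gal(L/K)} (hσ : σ ≠ 1)
    {x : L} (hx : σ x = x) : ∃ a : K, algebraMap K L a = x := by
  have : Finite K := finite_of_finite_extension K L
  have hx' : x ∈ (⊥ : IntermediateField K L) := by
    rw [IsGalois.mem_bot_iff_fixed]
    intro τ
    have := Fact.mk hL
    have hτ : τ ∈ Subgroup.zpowers σ :=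
      mem_zpowers_of_prime_card (IsGalois.card_aut_eq_finrank K L) hσ
    have hs : σ ∈ MulAction.stabilizer Gal(L/K) x := hx
    exact (Subgroup.zpowers_le.mpr hs) hτ
  exact IntermediateField.mem_bot.mp hx'

/-- Hilbert's Theorem 90 for an extension of prime degree of finite fields. -/
theorem exists_apply_eq_mul_of_norm_eq_one (hL : (finrank K L).Prime) {σ : Gal(L/K)} (hσ : σ ≠ 1)
    {e : L} (he : Algebra.norm K e = 1) : ∃ y : L, y ≠ 0 ∧ σ y = e * y := by
  have : Finite K := finite_of_finite_extension K L
  -- The map `y ↦ σ(y) / y` has its kernel in `Kˣ` and its image in the norm-one group; counting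
  -- shows that the image is the whole norm-one group.
  let f : Lˣ →* Lˣ := Units.map (σ : L →* L) / MonoidHom.id Lˣ
  have hf (y : Lˣ) : ((f y : Lˣ) : L) = σ y / y := by
    simp [f, Units.val_div_eq_div_val]
  have hker : Nat.card f.ker ≤ Nat.card Kˣ := by
    have hle : f.ker ≤ (Units.map (algebraMap K L : K →* L)).range := by
      intro y hy
      have h1 : σ y = y := by
        have := congrArg Units.val (MonoidHom.mem_ker.mp hy)
        rw [hf, Units.val_one, div_eq_one_iff_eq y.ne_zero] at this
        exact this
      obtain ⟨a, ha⟩ := mem_range_algebraMap_of_fixed hL hσ h1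
      refine ⟨Units.mk0 a ?_, Units.ext ha⟩
      rintro rfl
      exact y.ne_zero (by rw [← ha, map_zero])
    exact (Subgroup.card_le_of_le hle).trans
      (Nat.card_le_card_of_surjective _ (MonoidHom.rangeRestrict_surjective _))
  have hrange : f.range ≤ (Units.map (Algebra.norm K (S := L))).ker := by
    rintro _ ⟨y, rfl⟩
    rw [MonoidHom.mem_ker, Units.ext_iff]
    change Algebra.norm K ((f y : Lˣ) : L) = 1
    rw [hf, div_eq_mul_inv, map_mul, Algebra.norm_inv, Algebra.norm_eq_of_algEquiv]
    exact mul_inv_cancel₀ (by simp)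
  have heq : f.range = (Units.map (Algebra.norm K (S := L))).ker := by
    refine Subgroup.eq_of_le_of_card_ge hrange ?_
    have h1 := card_ker_unitsMap_norm_mul K L
    rw [← Subgroup.card_mul_index f.ker, Subgroup.index_ker, mul_comm (Nat.card f.ker)] at h1
    have h0 : 0 < Nat.card Kˣ := Nat.card_pos
    have h2 : Nat.card f.range * Nat.card f.ker ≤ Nat.card f.range * Nat.card Kˣ :=
      Nat.mul_le_mul_left _ hker
    exact Nat.le_of_mul_le_mul_right (h1.trans_le h2) h0
  have he0 : e ≠ 0 := by
    rintro rfl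
    have : finrank K L ≠ 0 := hL.ne_zero
    rw [Algebra.norm_zero] at he
    exact zero_ne_one he
  have hmem : Units.mk0 e he0 ∈ (Units.map (Algebra.norm K (S := L))).ker := by
    rw [MonoidHom.mem_ker, Units.ext_iff]
    exact he
  rw [← heq] at hmem
  obtain ⟨y, hy⟩ := hmem
  refine ⟨y, y.ne_zero, ?_⟩
  have := hf y
  rw [hy, Units.val_mk0, eq_div_iff y.ne_zero] at this
  exact this.symm

/-- The `K`-linear endomorphisms of a cubic extension of finite fields are the linearized
polynomials. -/
theorem exists_linearMap_eq_frobenius_sum [Fintype K] (hL : finrank K L = 3) (M : L →ₗ[K] L) :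
    ∃ a b c : L, ∀ y, M y = a * y + b * y ^ Fintype.card K + c * y ^ Fintype.card K ^ 2 := by
  -- By Dedekind the powers of Frobenius are independent over `L`; their number is the `L`-dimension
  -- of the endomorphism space, so they span it.
  have hb := FiniteField.bijective_frobeniusAlgHom_pow K L
  have hli := (linearIndependent_algHom_toLinearMap K L L).comp _ hb.1
  have hsp := hli.span_eq_top_of_card_eq_finrank' (by
    rw [Fintype.card_fin, Module.finrank_linearMap_self])
  have hM : M ∈ Submodule.span L (Set.range (AlgHom.toLinearMap ∘
      fun n : Fin (finrank K L) => FiniteField.frobeniusAlgHom K L ^ n.1)) := hsp ▸ trivial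
  obtain ⟨w, hw⟩ := (Submodule.mem_span_range_iff_exists_fun L).mp hM
  let e := finCongr hL.symm
  refine ⟨w (e 0), w (e 1), w (e 2), fun y => ?_⟩
  rw [← hw, ← e.sum_comp, Fin.sum_univ_three]
  simp [e, pow_two, pow_mul]

end FiniteFieldExtension

/-! ### Power sums that force a linear map to be a twisted automorphism. -/

section PowerSums

variable {K L : Type*} [Field K] [Field L] [Algebra K L]

theorem FiniteField.sum_units_pow_eq_zero [Fintype L] [DecidableEq L] {i : ℕ}
    (h : ¬ Fintype.card L - 1 ∣ i) : ∑ y : Lˣ, (y : L) ^ i = 0 := by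
  rw [FiniteField.sum_pow_units, if_neg h]

/-- A linear endomorphism `M` of a cubic extension of finite fields is a multiple of a nontrivial
automorphism as soon as two power sums of the values of `M y / y` vanish. -/
theorem exists_eq_mul_algEquiv_of_sum_pow_eq_zero [Fintype K] [Fintype L] [DecidableEq L]
    (hL : finrank K L = 3) (M : L →ₗ[K] L)
    (h1 : ∑ y : Lˣ, M y / (y : L) = 0)
    (h2 : ∑ y : Lˣ, (M y / (y : L)) ^ (Fintype.card K + 1) = 0) :
    ∃ (c : L) (σ : Gal(L/K)), σ ≠ 1 ∧ ∀ y, M y = c * σ y := by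
  obtain ⟨a, b, c, hM⟩ := exists_linearMap_eq_frobenius_sum hL M
  have hF (x y : L) :
      (x + y) ^ Fintype.card K = x ^ Fintype.card K + y ^ Fintype.card K :=
    map_add (FiniteField.frobeniusAlgHom K L) x y
  have hcard : Fintype.card L = Fintype.card K ^ 3 := by
    rw [Module.card_eq_pow_finrank (K := K) (V := L), hL]
  have hFr (y : L) :
      FiniteField.frobeniusAlgEquivOfAlgebraic K L y = y ^ Fintype.card K := rfl
  have hord : orderOf (FiniteField.frobeniusAlgEquivOfAlgebraic K L) = 3 := by
    rw [FiniteField.orderOf_frobeniusAlgEquivOfAlgebraic, hL]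
  have hq := Fintype.one_lt_card (α := K)
  generalize Fintype.card K = q at *
  obtain ⟨r, rfl⟩ : ∃ r, q = r + 2 := ⟨q - 2, by omega⟩
  have hcard1 : Fintype.card L - 1 = r ^ 3 + 6 * r ^ 2 + 12 * r + 7 := by
    rw [hcard]
    have : (r + 2) ^ 3 = r ^ 3 + 6 * r ^ 2 + 12 * r + 7 + 1 := by ring
    omega
  have hlt {i : ℕ} (h0 : 0 < i) (hi : i < r ^ 3 + 6 * r ^ 2 + 12 * r + 7) :
      ∑ y : Lˣ, (y : L) ^ i = 0 := by
    refine FiniteField.sum_units_pow_eq_zero fun hd => ?_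
    have := Nat.le_of_dvd h0 hd
    omega
  have hone (y : Lˣ) : (y : L) ^ (r ^ 3 + 6 * r ^ 2 + 12 * r + 7) = 1 := by
    rw [← hcard1]; exact FiniteField.pow_card_sub_one_eq_one _ y.ne_zero
  have hsum1 : ∑ _y : Lˣ, (1 : L) = -1 := by
    simpa using FiniteField.sum_pow_units L 0
  have hMy (y : Lˣ) : M y / (y : L) = a + b * y ^ (r + 1) + c * y ^ (r ^ 2 + 4 * r + 3) := by
    rw [hM, div_eq_iff y.ne_zero]
    ring
  -- The exponents `q - 1` and `q² - 1` lie strictly between 0 and `q³ - 1`, so only the constant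
  -- term survives summation.
  have ha : a = 0 := by
    have e1 : ∑ y : Lˣ, M y / (y : L) = a * ∑ _y : Lˣ, (1 : L) + b * ∑ y : Lˣ, (y : L) ^ (r + 1)
        + c * ∑ y : Lˣ, (y : L) ^ (r ^ 2 + 4 * r + 3) := by
      simp_rw [hMy, Finset.mul_sum, Finset.sum_add_distrib, mul_one]
    rw [h1, hlt (by omega) (by nlinarith), hlt (by omega) (by nlinarith), hsum1] at e1
    simpa using e1
  subst ha
  have hbc : b = 0 ∨ c = 0 := by
    -- The `q`-th power is additive, so the `(q + 1)`-st has four terms. The cross term `b c ^ q`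
    -- carries `y ^ (q³ - 1) = 1`; rewriting the factor `1` as that power leaves a polynomial
    -- identity.
    have e1 (y : Lˣ) : (M y / (y : L)) ^ (r + 2 + 1) =
        b ^ (r + 3) * y ^ (r ^ 2 + 4 * r + 3) + b * c ^ (r + 2) * 1
        + c * b ^ (r + 2) * y ^ (2 * r ^ 2 + 7 * r + 5)
        + c ^ (r + 3) * y ^ (r ^ 3 + 7 * r ^ 2 + 15 * r + 9) := by
      rw [hMy, pow_succ, zero_add, hF, ← hone y]
      ring
    have e2 : ∑ y : Lˣ, (M y / (y : L)) ^ (r + 2 + 1) =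
        b ^ (r + 3) * ∑ y : Lˣ, (y : L) ^ (r ^ 2 + 4 * r + 3) + b * c ^ (r + 2) * ∑ _y : Lˣ, (1 : L)
        + c * b ^ (r + 2) * ∑ y : Lˣ, (y : L) ^ (2 * r ^ 2 + 7 * r + 5)
        + c ^ (r + 3) * ∑ y : Lˣ, (y : L) ^ (r ^ 3 + 7 * r ^ 2 + 15 * r + 9) := by
      simp_rw [e1, Finset.mul_sum, Finset.sum_add_distrib]
    -- This exponent exceeds `q³ - 1`; modulo `q³ - 1` it is `q² - q`.
    have e3 : ∑ y : Lˣ, (y : L) ^ (r ^ 3 + 7 * r ^ 2 + 15 * r + 9) = 0 := by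
      have (y : Lˣ) : (y : L) ^ (r ^ 3 + 7 * r ^ 2 + 15 * r + 9) = y ^ (r ^ 2 + 3 * r + 2) := by
        rw [← one_mul ((y : L) ^ (r ^ 2 + 3 * r + 2)), ← hone y]
        ring
      simp_rw [this]
      exact hlt (by omega) (by nlinarith)
    rw [h2, hlt (by omega) (by nlinarith),
      hlt (by omega) (by nlinarith [Nat.zero_le (r ^ 3), Nat.zero_le (r ^ 2)]), hsum1, e3] at e2
    have : b * c ^ (r + 2) = 0 := by simpa using e2
    rcases mul_eq_zero.mp this with h | h
    · exact Or.inl h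
    · exact Or.inr (pow_eq_zero_iff (by omega) |>.mp h)
  set F := FiniteField.frobeniusAlgEquivOfAlgebraic K L
  rcases hbc with rfl | rfl
  · refine ⟨c, F ^ 2, fun h => ?_, fun y => ?_⟩
    · have := orderOf_le_of_pow_eq_one (by norm_num) h
      omega
    · rw [hM, pow_two F, AlgEquiv.mul_apply, hFr, hFr]
      ring
  · refine ⟨b, F, fun h => ?_, fun y => ?_⟩
    · rw [h, orderOf_one] at hord
      omega
    · rw [hM, hFr]
      ring

end PowerSums

/-! ### Graphs of multiples of automorphisms and their intersections. -/

section TwistedLines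

variable {K L : Type*} [Field K] [Field L] [Algebra K L]

/-- The graph `{(y, c σ(y)) | y ∈ L}` of a multiple of an automorphism, as a `K`-subspace. -/
def twistedLine (σ : Gal(L/K)) (c : L) : Submodule K (L × L) :=
  (LinearMap.mulLeft K c ∘ₗ σ.toLinearMap).graph

theorem mem_twistedLine {σ : Gal(L/K)} {c : L} {p : L × L} :
    p ∈ twistedLine σ c ↔ p.2 = c * σ p.1 := by
  simp [twistedLine, LinearMap.mem_graph_iff]

theorem lineOfSlope_coe (x : L) : lineOfSlope K (x : OnePoint L) = twistedLine (1 : Gal(L/K)) x := by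
  ext ⟨y, z⟩
  change (y, z) ∈ LinearMap.range (LinearMap.prod LinearMap.id (LinearMap.mulLeft K x)) ↔ _
  rw [mem_twistedLine]
  simp [eq_comm]

theorem finrank_graph (M : L →ₗ[K] L) : finrank K M.graph = finrank K L := by
  rw [LinearMap.graph_eq_range_prod, LinearMap.finrank_range_of_inj]
  intro x y h
  exact congrArg Prod.fst h

theorem finrank_twistedLine (σ : Gal(L/K)) (c : L) :
    finrank K (twistedLine σ c) = finrank K L :=
  finrank_graph _

theorem finrank_lineOfSlope (z : OnePoint L) : finrank K (lineOfSlope K z) = finrank K L := by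
  induction z using OnePoint.rec with
  | infty => exact LinearMap.finrank_range_of_inj LinearMap.inr_injective
  | coe x => rw [lineOfSlope_coe, finrank_twistedLine]

theorem twistedLine_inf_eq_bot {σ : Gal(L/K)} {c d : L} (h : c ≠ d) :
    twistedLine σ c ⊓ twistedLine σ d = ⊥ := by
  rw [eq_bot_iff]
  rintro ⟨y, z⟩ ⟨h1, h2⟩
  rw [SetLike.mem_coe, mem_twistedLine] at h1 h2
  dsimp only at h1 h2
  have h3 : (c - d) * σ y = 0 := by rw [sub_mul, ← h1, ← h2, sub_self]
  have hy : y = 0 := by simpa [sub_ne_zero.mpr h] using h3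
  simp [h1, hy]

variable [Finite L]

/-- Hilbert's Theorem 90 in geometric form. -/
theorem finrank_twistedLine_inf_twistedLine (hL : (finrank K L).Prime) {σ τ : Gal(L/K)}
    (hστ : σ ≠ τ) {c d : L} (hc : Algebra.norm K c = 1) (hd : Algebra.norm K d = 1) :
    finrank K (twistedLine σ c ⊓ twistedLine τ d : Submodule K (L × L)) = 1 := by
  have hρ : τ⁻¹ * σ ≠ 1 := fun h => hστ (inv_mul_eq_one.mp h).symm
  have hnz {x : L} (hx : Algebra.norm K x = 1) : x ≠ 0 := by
    rintro rfl
    rw [Algebra.norm_zero] at hx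
    exact zero_ne_one hx
  -- Applying `τ⁻¹` turns `c σ(y) = d τ(y)` into the Hilbert 90 equation for `τ⁻¹ σ`.
  have he : Algebra.norm K (τ⁻¹ (d / c)) = 1 := by
    rw [Algebra.norm_eq_of_algEquiv, div_eq_mul_inv, map_mul, Algebra.norm_inv, hc, hd]
    simp
  obtain ⟨y, hy0, hy⟩ := exists_apply_eq_mul_of_norm_eq_one hL hρ he
  have key : c * σ y = d * τ y := by
    have := congrArg τ hy
    rw [map_mul, AlgEquiv.mul_apply] at this
    change τ (τ.symm (σ y)) = τ (τ.symm (d / c)) * τ y at this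
    rw [AlgEquiv.apply_symm_apply, AlgEquiv.apply_symm_apply] at this
    rw [this]
    field_simp [hnz hc]
  refine finrank_eq_one_iff_of_nonzero' (⟨(y, c * σ y), ?_, ?_⟩ :
    (twistedLine σ c ⊓ twistedLine τ d : Submodule K (L × L))) ?_ |>.mpr ?_
  · exact mem_twistedLine.mpr rfl
  · exact mem_twistedLine.mpr key
  · intro h
    exact hy0 (congrArg (fun p => p.1.1) h)
  · rintro ⟨⟨u, v⟩, hu, hv⟩
    rw [SetLike.mem_coe, mem_twistedLine] at hu hv
    dsimp only at hu hv
    -- The quotient of two solutions is fixed by `τ⁻¹ σ`, hence lies in `K`: the solution space is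
    -- one-dimensional.
    have hfix : σ (u / y) = τ (u / y) := by
      have hσy : σ y ≠ 0 := by simpa using hy0
      have hτy : τ y ≠ 0 := by simpa using hy0
      rw [map_div₀, map_div₀, div_eq_div_iff hσy hτy]
      have h1 : c * σ u = d * τ u := hu.symm.trans hv
      apply mul_left_cancel₀ (mul_ne_zero (hnz hc) (hnz hd))
      linear_combination d * τ y * h1 - d * τ u * key
    obtain ⟨a, ha⟩ := mem_range_algebraMap_of_fixed hL hρ (x := u / y) (by
      rw [AlgEquiv.mul_apply, hfix]
      exact τ.symm_apply_apply _)
    refine ⟨a, Subtype.ext (Prod.ext ?_ ?_)⟩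
    · change a • y = u
      rw [Algebra.smul_def, ha]
      field_simp
    · change a • (c * σ y) = v
      have : u = a • y := by
        rw [Algebra.smul_def, ha]
        field_simp
      rw [hu, this, map_smul, mul_smul_comm]

end TwistedLines

/-! ### Planes meeting every plane of the norm-one family. -/

section NormSurface

variable {K L : Type*} [Field K] [Field L] [Algebra K L] [Fintype K] [Fintype L]

/-- Projective points are counted through nonzero vectors, `q - 1` to each point. -/
theorem Submodule.card_filter_ne_zero {E : Type*} [AddCommGroup E] [Module K E] [Fintype E]
    [DecidableEq E] (W : Submodule K E) [DecidablePred (· ∈ W)] :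
    (Finset.univ.filter fun p : E => p ∈ W ∧ p ≠ 0).card = Fintype.card K ^ finrank K W - 1 := by
  have h : Fintype.card W = Fintype.card K ^ finrank K W := Module.card_eq_pow_finrank
  rw [← h, Fintype.card_subtype, ← Finset.card_erase_of_mem (a := (0 : E)) (by simp)]
  congr 1
  ext p
  simp [and_comm]

/-- A plane that meets all lines of slope of norm one has all its points on these lines,
one on each. -/
theorem points_of_forall_inf_ne_bot (hL : finrank K L = 3) (P : Submodule K (L × L))
    (hP : finrank K P = 3)
    (h : ∀ u : L, Algebra.norm K u = 1 → P ⊓ twistedLine (1 : Gal(L/K)) u ≠ ⊥) :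
    (∀ p ∈ P, p ≠ 0 → ∃ u : L, Algebra.norm K u = 1 ∧ p.2 = u * p.1) ∧
    ∀ u : L, Algebra.norm K u = 1 →
      finrank K (P ⊓ twistedLine (1 : Gal(L/K)) u : Submodule K (L × L)) = 1 := by
  classical
  let U : Finset L := Finset.univ.filter fun u => Algebra.norm K u = 1
  have hU : U.card = Fintype.card K ^ 2 + Fintype.card K + 1 := by
    rw [← Nat.card_eq_fintype_card (α := K), ← card_norm_eq_one hL, Nat.card_eq_fintype_card,
      Fintype.card_subtype]
  have hq := Fintype.one_lt_card (α := K)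
  let W (u : L) : Submodule K (L × L) := P ⊓ twistedLine (1 : Gal(L/K)) u
  let A (u : L) : Finset (L × L) := Finset.univ.filter fun p => p ∈ W u ∧ p ≠ 0
  have hA (u : L) : (A u).card = Fintype.card K ^ finrank K (W u) - 1 :=
    Submodule.card_filter_ne_zero _
  have hApos (u : L) (hu : u ∈ U) : Fintype.card K - 1 ≤ (A u).card := by
    have h1 : 1 ≤ finrank K (W u) :=
      Submodule.one_le_finrank_iff.mpr (h u (Finset.mem_filter.mp hu).2)
    have := Nat.pow_le_pow_right hq.le h1
    rw [pow_one] at this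
    rw [hA]
    omega
  have hdisj : ∀ u ∈ U, ∀ v ∈ U, u ≠ v → Disjoint (A u) (A v) := by
    intro u _ v _ huv
    rw [Finset.disjoint_left]
    intro p hpu hpv
    have h1 := (Finset.mem_filter.mp hpu).2
    have h2 := (Finset.mem_filter.mp hpv).2
    have : p ∈ twistedLine (1 : Gal(L/K)) u ⊓ twistedLine (1 : Gal(L/K)) v := ⟨h1.1.2, h2.1.2⟩
    rw [twistedLine_inf_eq_bot huv] at this
    exact h1.2 this
  let B : Finset (L × L) := Finset.univ.filter fun p => p ∈ P ∧ p ≠ 0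
  have hB : B.card = Fintype.card K ^ 3 - 1 := by
    rw [← hP]
    exact Submodule.card_filter_ne_zero _
  have hsub : U.biUnion A ⊆ B := by
    intro p hp
    obtain ⟨u, _, hpu⟩ := Finset.mem_biUnion.mp hp
    have := (Finset.mem_filter.mp hpu).2
    exact Finset.mem_filter.mpr ⟨Finset.mem_univ _, this.1.1, this.2⟩
  have hcardU : (U.biUnion A).card = ∑ u ∈ U, (A u).card := Finset.card_biUnion hdisj
  -- At least `q - 1` nonzero vectors on each of `q² + q + 1` disjoint pieces already account for
  -- all `q³ - 1` nonzero vectors of `P`, so every inequality is an equality.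
  have hconst : ∑ _u ∈ U, (Fintype.card K - 1) = B.card := by
    rw [Finset.sum_const, hU, hB, smul_eq_mul]
    generalize Fintype.card K = q at hq
    obtain ⟨r, rfl⟩ : ∃ r, q = r + 1 := ⟨q - 1, by omega⟩
    have : (r + 1) ^ 3 = ((r + 1) ^ 2 + (r + 1) + 1) * r + 1 := by ring
    rw [this]
    simp
  have hle := Finset.card_le_card hsub
  have hge := Finset.sum_le_sum hApos
  have heq : U.biUnion A = B := Finset.eq_of_subset_of_card_le hsub (by omega)
  have hsumeq := (Finset.sum_eq_sum_iff_of_le hApos).mp (by omega)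
  constructor
  · intro p hp hp0
    have : p ∈ U.biUnion A := heq ▸ Finset.mem_filter.mpr ⟨Finset.mem_univ _, hp, hp0⟩
    obtain ⟨u, hu, hpu⟩ := Finset.mem_biUnion.mp this
    exact ⟨u, (Finset.mem_filter.mp hu).2, mem_twistedLine.mp (Finset.mem_filter.mp hpu).2.1.2⟩
  · intro u hu
    have h1 := hsumeq u (Finset.mem_filter.mpr ⟨Finset.mem_univ _, hu⟩)
    rw [hA] at h1
    have h2 : Fintype.card K ^ finrank K (W u) = Fintype.card K ^ 1 := by
      have := Nat.one_le_pow (finrank K (W u)) (Fintype.card K) (by omega)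
      rw [pow_one]
      omega
    exact Nat.pow_right_injective hq h2

/-- All nonzero vectors of `P` have finite slope, so the first projection is injective on `P`, and
bijective by dimension. -/
theorem exists_eq_graph_of_forall_inf_ne_bot (hL : finrank K L = 3) (P : Submodule K (L × L))
    (hP : finrank K P = 3)
    (h : ∀ u : L, Algebra.norm K u = 1 → P ⊓ twistedLine (1 : Gal(L/K)) u ≠ ⊥) :
    ∃ M : L →ₗ[K] L, P = M.graph := by
  have hpt := (points_of_forall_inf_ne_bot hL P hP h).1
  have hinj : Function.Injective (LinearMap.fst K L L ∘ₗ P.subtype) := by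
    rw [injective_iff_map_eq_zero]
    rintro ⟨p, hp⟩ h0
    change p.1 = 0 at h0
    by_contra hne
    obtain ⟨u, _, hu⟩ := hpt p hp fun hp0 => hne (Subtype.ext hp0)
    exact hne (Subtype.ext (Prod.ext h0 (by rw [hu, h0, mul_zero]; rfl)))
  have hsurj : Function.Surjective (LinearMap.fst K L L ∘ₗ P.subtype) :=
    (LinearMap.injective_iff_surjective_of_finrank_eq_finrank (by rw [hP, hL])).mp hinj
  obtain ⟨M, hM⟩ := LinearMap.exists_range_eq_graph (f := P.subtype) hsurj fun p₁ p₂ h12 => by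
    rw [hinj h12]
  exact ⟨M, by rw [← hM, Submodule.range_subtype]⟩

-- The fibre of `y ↦ M y / y` over `u` is the set of nonzero vectors of a single point of the graph.
-- The right-hand side does not involve `M`, so any two such maps have equal power sums.
open Classical in
theorem sum_units_div_pow_eq_of_graph (hL : finrank K L = 3) (M : L →ₗ[K] L)
    (h : ∀ u : L, Algebra.norm K u = 1 → M.graph ⊓ twistedLine (1 : Gal(L/K)) u ≠ ⊥) (k : ℕ) :
    ∑ y : Lˣ, (M y / (y : L)) ^ k =
      ∑ u : L with Algebra.norm K u = 1, (Fintype.card K - 1) • u ^ k := by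
  obtain ⟨h1, h2⟩ := points_of_forall_inf_ne_bot hL M.graph ((finrank_graph M).trans hL) h
  rw [← Finset.sum_fiberwise_of_maps_to (g := fun y : Lˣ => M y / (y : L))
    (t := Finset.univ.filter fun u : L => Algebra.norm K u = 1)]
  · refine Finset.sum_congr rfl fun u hu => ?_
    rw [Finset.sum_congr rfl (g := fun _ => u ^ k), Finset.sum_const]
    · congr 1
      have hW := Submodule.card_filter_ne_zero (M.graph ⊓ twistedLine (1 : Gal(L/K)) u)
      rw [h2 u (Finset.mem_filter.mp hu).2, pow_one] at hW
      rw [← hW]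
      refine Finset.card_bij (fun y _ => ((y : L), M y)) ?_ ?_ ?_
      · intro y hy
        have hy' : M y / (y : L) = u := (Finset.mem_filter.mp hy).2
        rw [div_eq_iff y.ne_zero] at hy'
        refine Finset.mem_filter.mpr ⟨Finset.mem_univ _, ⟨?_, mem_twistedLine.mpr hy'⟩, ?_⟩
        · exact (LinearMap.mem_graph_iff _ _).mpr rfl
        · exact fun h0 => y.ne_zero (congrArg Prod.fst h0)
      · intro y _ z _ hyz
        exact Units.ext (congrArg Prod.fst hyz)
      · rintro ⟨y, z⟩ hyz
        obtain ⟨-, ⟨hz, hu⟩, h0⟩ := Finset.mem_filter.mp hyz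
        have hz' : z = M y := (LinearMap.mem_graph_iff _ _).mp hz
        have hu' : z = u * y := mem_twistedLine.mp hu
        have hy : y ≠ 0 := by
          rintro rfl
          exact h0 (by rw [hz', map_zero]; rfl)
        refine ⟨Units.mk0 y hy, Finset.mem_filter.mpr ⟨Finset.mem_univ _, ?_⟩, ?_⟩
        · change M y / y = u
          rw [div_eq_iff hy, ← hz', hu']
        · rw [hz']; rfl
    · intro y hy
      rw [(Finset.mem_filter.mp hy).2]
  · intro y _
    obtain ⟨u, hu, hyu⟩ := h1 (y, M y) ((LinearMap.mem_graph_iff _ _).mpr rfl)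
      fun h0 => y.ne_zero (congrArg Prod.fst h0)
    have : M y / (y : L) = u := by rw [div_eq_iff y.ne_zero]; exact hyu
    rw [this]
    exact Finset.mem_filter.mpr ⟨Finset.mem_univ _, hu⟩

end NormSurface

/-! ### The planes meeting all members of the norm-one family are twisted lines. -/

section Classification

variable {K L : Type*} [Field K] [Field L] [Algebra K L]

theorem exists_eq_twistedLine_of_forall_inf_ne_bot [Finite L] (hL : finrank K L = 3)
    (P : Submodule K (L × L)) (hP : finrank K P = 3)
    (h : ∀ u : L, Algebra.norm K u = 1 → P ⊓ twistedLine (1 : Gal(L/K)) u ≠ ⊥) :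
    ∃ (σ : Gal(L/K)) (c : L), σ ≠ 1 ∧ Algebra.norm K c = 1 ∧ P = twistedLine σ c := by
  classical
  have := Fintype.ofFinite L
  have : Finite K := finite_of_finite_extension K L
  have := Fintype.ofFinite K
  have hpt := (points_of_forall_inf_ne_bot hL P hP h).1
  obtain ⟨M, rfl⟩ := exists_eq_graph_of_forall_inf_ne_bot hL P hP h
  let F := FiniteField.frobeniusAlgEquivOfAlgebraic K L
  have hF1 : F ≠ 1 := by
    intro h1
    have hord : orderOf F = finrank K L := FiniteField.orderOf_frobeniusAlgEquivOfAlgebraic K L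
    rw [h1, orderOf_one, hL] at hord
    omega
  have hp : (finrank K L).Prime := hL ▸ Nat.prime_three
  have hFmeet (u : L) (hu : Algebra.norm K u = 1) :
      F.toLinearMap.graph ⊓ twistedLine (1 : Gal(L/K)) u ≠ ⊥ := by
    have hgr : F.toLinearMap.graph = twistedLine F 1 := by
      ext ⟨y, z⟩
      simp [mem_twistedLine, LinearMap.mem_graph_iff]
    rw [hgr, ← Submodule.one_le_finrank_iff]
    exact (finrank_twistedLine_inf_twistedLine hp hF1 (map_one _) hu).ge
  have hq := Fintype.one_lt_card (α := K)
  have hcard : Fintype.card L = Fintype.card K ^ 3 := by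
    rw [Module.card_eq_pow_finrank (K := K) (V := L), hL]
  -- Frobenius serves as the comparison map: its quotients are `y ^ (q - 1)`, and `0 < (q - 1) k ≤
  -- q² - 1 < q³ - 1` makes the sum vanish.
  have hsum (k : ℕ) (h0 : 0 < k) (hk : k ≤ Fintype.card K + 1) :
      ∑ y : Lˣ, (M y / (y : L)) ^ k = 0 := by
    rw [sum_units_div_pow_eq_of_graph hL M h k,
      ← sum_units_div_pow_eq_of_graph hL F.toLinearMap hFmeet k]
    have (y : Lˣ) : (F.toLinearMap y / (y : L)) ^ k = (y : L) ^ ((Fintype.card K - 1) * k) := by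
      have hFy : F.toLinearMap (y : L) = (y : L) ^ Fintype.card K := rfl
      rw [hFy, pow_mul, pow_sub₀ _ y.ne_zero hq.le, pow_one, div_eq_mul_inv]
    simp_rw [this]
    refine FiniteField.sum_units_pow_eq_zero fun hd => ?_
    rw [hcard] at hd
    generalize Fintype.card K = q at hq hk hd
    obtain ⟨r, rfl⟩ : ∃ r, q = r + 2 := ⟨q - 2, by omega⟩
    have h3 : (r + 2) ^ 3 - 1 = r ^ 3 + 6 * r ^ 2 + 12 * r + 7 := by
      have : (r + 2) ^ 3 = r ^ 3 + 6 * r ^ 2 + 12 * r + 7 + 1 := by ring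
      omega
    rw [h3, show r + 2 - 1 = r + 1 by omega] at hd
    have hle := Nat.le_of_dvd (by positivity) hd
    have := Nat.mul_le_mul_left (r + 1) hk
    nlinarith [Nat.zero_le (r ^ 3)]
  obtain ⟨c, σ, hσ, hM⟩ := exists_eq_mul_algEquiv_of_sum_pow_eq_zero hL M
    (by simpa using hsum 1 one_pos (by omega)) (hsum _ (by omega) le_rfl)
  refine ⟨σ, c, hσ, ?_, ?_⟩
  -- Since `M 1 = c`, the slope of this vector is `c`, so `c` has norm one.
  · obtain ⟨u, hu, hu1⟩ := hpt (1, M 1) ((LinearMap.mem_graph_iff _ _).mpr rfl)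
      fun h0 => one_ne_zero (congrArg Prod.fst h0)
    have : c = u := by simpa [hM] using hu1
    rwa [this]
  · ext ⟨y, z⟩
    rw [mem_twistedLine, LinearMap.mem_graph_iff]
    simp [hM]

end Classification

/-! ### Reduction of an arbitrary cover to the elements of norm one. -/

section NormalForm

variable {K L V : Type*} [Field K] [Field L] [Algebra K L] [AddCommGroup V] [Module K V]

/-- The image in `V` of the twisted lines with a given automorphism and coefficients of norm one. -/
def twistedFamily (ψ : (L × L) ≃ₗ[K] V) (σ : Gal(L/K)) : Set (Submodule K V) :=
  (fun c => (twistedLine σ c).map ψ.toLinearMap) '' {c | Algebra.norm K c = 1}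

/-- The `K`-linear map underlying the projectivity with the given matrix. -/
def projectivityMap (K : Type*) {L : Type*} [Field K] [Field L] [Algebra K L] (a b c d : L) :
    (L × L) →ₗ[K] (L × L) where
  toFun p := (a * p.1 + b * p.2, c * p.1 + d * p.2)
  map_add' p q := by ext <;> simp <;> ring
  map_smul' k p := by ext <;> simp [smul_add]

theorem projectivityMap_injective {a b c d : L} (h : a * d - b * c ≠ 0) :
    Function.Injective (projectivityMap K a b c d) := by
  rw [injective_iff_map_eq_zero]
  rintro ⟨y, z⟩ h0
  have h1 : a * y + b * z = 0 := congrArg Prod.fst h0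
  have h2 : c * y + d * z = 0 := congrArg Prod.snd h0
  have hy : (a * d - b * c) * y = 0 := by linear_combination d * h1 - b * h2
  have hz : (a * d - b * c) * z = 0 := by linear_combination a * h2 - c * h1
  exact Prod.ext ((mul_eq_zero.mp hy).resolve_left h) ((mul_eq_zero.mp hz).resolve_left h)

theorem map_projectivityMap_twistedLine [FiniteDimensional K L] {a b c d : L}
    (h : a * d - b * c ≠ 0) {u : L} {z : OnePoint L}
    (hz : ∀ y : L, projectivityMap K a b c d (y, u * y) ∈ lineOfSlope K z) :
    (twistedLine (1 : Gal(L/K)) u).map (projectivityMap K a b c d) = lineOfSlope K z := by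
  refine Submodule.eq_of_le_of_finrank_eq ?_ ?_
  · rintro _ ⟨⟨y, w⟩, hy, rfl⟩
    have hw : w = u * y := mem_twistedLine.mp hy
    rw [hw]
    exact hz y
  · rw [← (Submodule.equivMapOfInjective _ (projectivityMap_injective h) _).finrank_eq,
      finrank_twistedLine, finrank_lineOfSlope]

theorem mem_lineOfSlope_coe {x : L} {p : L × L} :
    p ∈ lineOfSlope K (x : OnePoint L) ↔ p.2 = x * p.1 := by
  rw [lineOfSlope_coe, mem_twistedLine]; rfl

theorem mem_lineOfSlope_infty {p : L × L} :
    p ∈ lineOfSlope K (OnePoint.infty : OnePoint L) ↔ p.1 = 0 := by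
  change p ∈ LinearMap.range (LinearMap.inr K L L) ↔ _
  rw [LinearMap.range_inr]; simp

variable [Finite L]

theorem algebraNorm_div {x y : L} : Algebra.norm K (x / y) = Algebra.norm K x / Algebra.norm K y := by
  rw [div_eq_mul_inv, map_mul, Algebra.norm_inv, div_eq_mul_inv]

/-- All covers are equivalent to the set of elements of norm one under projectivities. -/
theorem IsCover.exists_linearEquiv {C : Set (OnePoint L)} (hC : IsCover K C) :
    ∃ g : (L × L) ≃ₗ[K] (L × L), lineOfSlope K '' C = twistedFamily g 1 := by
  -- On slopes the matrix acts by `u ↦ (c + d u) / (a + b u)`.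
  suffices H : ∃ a b c d : L, a * d - b * c ≠ 0 ∧
      (∀ u : L, Algebra.norm K u = 1 → ∃ z ∈ C,
        ∀ y : L, projectivityMap K a b c d (y, u * y) ∈ lineOfSlope K z) ∧
      (∀ z ∈ C, ∃ u : L, Algebra.norm K u = 1 ∧
        ∀ y : L, projectivityMap K a b c d (y, u * y) ∈ lineOfSlope K z) by
    obtain ⟨a, b, c, d, hdet, h1, h2⟩ := H
    let g := LinearEquiv.ofInjectiveEndo _ (projectivityMap_injective (K := K) hdet)
    have hg : g.toLinearMap = projectivityMap K a b c d := LinearMap.ext fun _ => rfl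
    refine ⟨g, ?_⟩
    ext W
    constructor
    · rintro ⟨z, hz, rfl⟩
      obtain ⟨u, hu, huz⟩ := h2 z hz
      refine ⟨u, hu, ?_⟩
      dsimp only
      rw [hg, map_projectivityMap_twistedLine hdet huz]
    · rintro ⟨u, hu, rfl⟩
      obtain ⟨z, hz, huz⟩ := h1 u hu
      refine ⟨z, hz, ?_⟩
      dsimp only
      rw [hg, map_projectivityMap_twistedLine hdet huz]
  have hn0 {x : L} (hx : Algebra.norm K x ≠ 0) : x ≠ 0 := by
    rintro rfl
    exact hx Algebra.norm_zero
  rcases hC with ⟨a, f, hf, rfl⟩ | ⟨a, b, f, hab, hf, rfl⟩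
  · obtain ⟨w, hw⟩ := FiniteField.norm_surjective K L f
    have hw0 : w ≠ 0 := hn0 (hw ▸ hf)
    -- The slope map is `u ↦ a + w u` with `N(w) = f`.
    refine ⟨1, 0, a, w, by simpa using hw0, fun u hu => ⟨((a + w * u : L) : OnePoint L),
      ⟨_, rfl, by simp [hu, hw]⟩, fun y => ?_⟩, ?_⟩
    · rw [mem_lineOfSlope_coe]
      simp only [projectivityMap, LinearMap.coe_mk, AddHom.coe_mk]
      ring
    · rintro _ ⟨x, rfl, hx⟩
      refine ⟨(x - a) / w, by rw [algebraNorm_div, hx, hw, div_self hf], fun y => ?_⟩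
      rw [mem_lineOfSlope_coe]
      simp only [projectivityMap, LinearMap.coe_mk, AddHom.coe_mk]
      field_simp
      ring
  · obtain ⟨w, hw⟩ := FiniteField.norm_surjective K L f
    have hw0 : w ≠ 0 := hn0 (hw ▸ hf)
    have hab' : a - b ≠ 0 := sub_ne_zero.mpr hab
    -- Solving `(x - a) / (x - b) = w u` gives `x = (a - b w u) / (1 - w u)`; the value `∞` occurs
    -- when `w u = 1`, which forces `f = 1`.
    refine ⟨1, -w, a, -(b * w), ?_, fun u hu => ?_, ?_⟩
    · rw [show 1 * -(b * w) - -w * a = (a - b) * w by ring]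
      exact mul_ne_zero hab' hw0
    · have hwu : Algebra.norm K (w * u) = f := by rw [map_mul, hw, hu, mul_one]
      by_cases h1 : w * u = 1
      · refine ⟨OnePoint.infty, Or.inr ⟨rfl, by rw [← hwu, h1, map_one]⟩, fun y => ?_⟩
        rw [mem_lineOfSlope_infty]
        simp only [projectivityMap, LinearMap.coe_mk, AddHom.coe_mk]
        linear_combination (-y) * h1
      · have h1' : 1 - w * u ≠ 0 := sub_ne_zero.mpr (Ne.symm h1)
        have hu0 : u ≠ 0 := hn0 (by rw [hu]; exact one_ne_zero)
        have hxb : (a - b * (w * u)) / (1 - w * u) - b = (a - b) / (1 - w * u) := by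
          field_simp
          ring
        have hxa : (a - b * (w * u)) / (1 - w * u) - a = (a - b) * (w * u) / (1 - w * u) := by
          field_simp
          ring
        refine ⟨(((a - b * (w * u)) / (1 - w * u) : L) : OnePoint L),
          Or.inl ⟨_, rfl, ?_, ?_⟩, fun y => ?_⟩
        · rw [← sub_ne_zero, hxb]
          exact div_ne_zero hab' h1'
        · rw [hxa, hxb, ← hwu]
          congr 1
          field_simp
        · rw [mem_lineOfSlope_coe]
          simp only [projectivityMap, LinearMap.coe_mk, AddHom.coe_mk]
          field_simp
          ring
    · rintro z (⟨x, rfl, hxb, hx⟩ | ⟨rfl, rfl⟩)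
      · have hxb' : x - b ≠ 0 := sub_ne_zero.mpr hxb
        refine ⟨(x - a) / (x - b) / w, by rw [algebraNorm_div, hx, hw, div_self hf], fun y => ?_⟩
        rw [mem_lineOfSlope_coe]
        simp only [projectivityMap, LinearMap.coe_mk, AddHom.coe_mk]
        field_simp
        ring
      · refine ⟨w⁻¹, by rw [Algebra.norm_inv, hw, inv_one], fun y => ?_⟩
        rw [mem_lineOfSlope_infty]
        simp only [projectivityMap, LinearMap.coe_mk, AddHom.coe_mk]
        field_simp
        ring

/-- The projectivity is `K`-linear, so it can be absorbed into the identification of `V` with `L ×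
L`. -/
theorem IsAndreHyperRegulus.exists_eq_twistedFamily {X : Set (Submodule K V)}
    (hX : IsAndreHyperRegulus L X) : ∃ ψ : (L × L) ≃ₗ[K] V, X = twistedFamily ψ 1 := by
  obtain ⟨φ, C, hC, rfl⟩ := hX
  obtain ⟨g, hg⟩ := hC.exists_linearEquiv
  refine ⟨g.trans φ, ?_⟩
  have h1 : spreadPlane φ '' C = (Submodule.map φ.toLinearMap) '' (lineOfSlope K '' C) := by
    rw [Set.image_image]; rfl
  rw [h1, hg, twistedFamily, twistedFamily, Set.image_image]
  refine Set.image_congr fun c _ => ?_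
  rw [← Submodule.map_comp]
  rfl

end NormalForm

/-! ### Transport to `V` and uniqueness of the switching sets. -/

section SwitchingSets

variable {K L V : Type*} [Field K] [Field L] [Algebra K L] [AddCommGroup V] [Module K V] [Finite L]

theorem twistedFamily_isDisjointPlaneFamily (hL : finrank K L = 3) (ψ : (L × L) ≃ₗ[K] V)
    (σ : Gal(L/K)) : IsDisjointPlaneFamily (twistedFamily ψ σ) where
  isPlane := by
    rintro _ ⟨c, _, rfl⟩
    exact (LinearEquiv.finrank_map_eq ψ _).trans ((finrank_twistedLine σ c).trans hL)
  disjoint := by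
    rintro _ ⟨c, _, rfl⟩ _ ⟨d, _, rfl⟩ hne
    dsimp only
    rw [← Submodule.map_inf _ ψ.injective, twistedLine_inf_eq_bot, Submodule.map_bot]
    rintro rfl
    exact hne rfl
  ncard_eq := by
    have : Finite K := finite_of_finite_extension K L
    rw [twistedFamily, Set.ncard_image_of_injective, ← card_norm_eq_one hL]
    · rfl
    · intro c d hcd
      have h1 : twistedLine σ c = twistedLine σ d :=
        Submodule.map_injective_of_injective ψ.injective hcd
      by_contra hne
      have h2 := twistedLine_inf_eq_bot (K := K) (σ := σ) hne
      have h3 := finrank_twistedLine σ c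
      rw [h1, inf_idem] at h2
      rw [h1, h2, finrank_bot, hL] at h3
      omega

theorem twistedFamily_meetInPoint (hL : finrank K L = 3) (ψ : (L × L) ≃ₗ[K] V)
    {σ τ : Gal(L/K)} (hστ : σ ≠ τ) :
    ∀ P ∈ twistedFamily ψ σ, ∀ Q ∈ twistedFamily ψ τ, MeetInPoint P Q := by
  rintro _ ⟨c, hc, rfl⟩ _ ⟨d, hd, rfl⟩
  dsimp only [MeetInPoint]
  rw [← Submodule.map_inf _ ψ.injective]
  exact (LinearEquiv.finrank_map_eq ψ _).trans
    (finrank_twistedLine_inf_twistedLine (hL ▸ Nat.prime_three) hστ hc hd)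

theorem exists_mem_twistedFamily (hL : finrank K L = 3) (ψ : (L × L) ≃ₗ[K] V)
    {P : Submodule K V} (hP : IsPlane P) (h : ∀ Q ∈ twistedFamily ψ 1, P ⊓ Q ≠ ⊥) :
    ∃ σ : Gal(L/K), σ ≠ 1 ∧ P ∈ twistedFamily ψ σ := by
  obtain ⟨W, rfl⟩ : ∃ W, Submodule.map ψ.toLinearMap W = P :=
    Submodule.map_surjective_of_surjective ψ.surjective P
  obtain ⟨σ, c, hσ, hc, rfl⟩ := exists_eq_twistedLine_of_forall_inf_ne_bot hL W
    ((LinearEquiv.finrank_map_eq ψ _).symm.trans hP) fun u hu h0 => by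
      refine h _ ⟨u, hu, rfl⟩ ?_
      dsimp only
      rw [← Submodule.map_inf _ ψ.injective, h0, Submodule.map_bot]
  exact ⟨σ, hσ, c, hc, rfl⟩

theorem exists_galois_eq_or_eq_or_eq (hL : finrank K L = 3) :
    ∃ σ τ : Gal(L/K), σ ≠ 1 ∧ τ ≠ 1 ∧ σ ≠ τ ∧ ∀ ρ : Gal(L/K), ρ ≠ 1 → ρ = σ ∨ ρ = τ := by
  classical
  have : Finite K := finite_of_finite_extension K L
  have hcard : Fintype.card Gal(L/K) = 3 := by
    rw [← Nat.card_eq_fintype_card, IsGalois.card_aut_eq_finrank, hL]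
  have h2 : (Finset.univ.erase (1 : Gal(L/K))).card = 2 := by
    rw [Finset.card_erase_of_mem (Finset.mem_univ _), Finset.card_univ, hcard]
  obtain ⟨σ, τ, hne, he⟩ := Finset.card_eq_two.mp h2
  have key (ρ : Gal(L/K)) : ρ ≠ 1 ↔ ρ = σ ∨ ρ = τ := by
    simpa using Finset.ext_iff.mp he ρ
  exact ⟨σ, τ, (key σ).mpr (Or.inl rfl), (key τ).mpr (Or.inr rfl), hne, fun ρ => (key ρ).mp⟩

theorem IsDisjointPlaneFamily.eq_of_subset [Finite K] {S T : Set (Submodule K V)}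
    (hS : IsDisjointPlaneFamily S) (hT : IsDisjointPlaneFamily T) (h : T ⊆ S) : T = S := by
  -- Infinite sets have `ncard` zero, so a nonzero value yields finiteness.
  have hfin : S.Finite := Set.finite_of_ncard_ne_zero (by rw [hS.ncard_eq]; omega)
  exact Set.eq_of_subset_of_ncard_le h (by rw [hS.ncard_eq, hT.ncard_eq]) hfin

/-- A family of mutually disjoint planes contained in the union of two families that meet each
other in points is one of the two. -/
theorem IsDisjointPlaneFamily.eq_or_eq_of_subset_union [Finite K] {S S' T : Set (Submodule K V)}
    (hS : IsDisjointPlaneFamily S) (hS' : IsDisjointPlaneFamily S') (hT : IsDisjointPlaneFamily T)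
    (hmeet : ∀ P ∈ S, ∀ Q ∈ S', MeetInPoint P Q) (h : T ⊆ S ∪ S') : T = S ∨ T = S' := by
  by_cases hTS' : T ⊆ S'
  · exact Or.inr (hS'.eq_of_subset hT hTS')
  · obtain ⟨P, hP, hPS'⟩ := Set.not_subset.mp hTS'
    have hPS := (h hP).resolve_right hPS'
    -- A member `Q` of `T` in `S'` would meet `P` in a point, against disjointness within `T`.
    refine Or.inl (hS.eq_of_subset hT fun Q hQ => (h hQ).resolve_right fun hQS' => ?_)
    have h1 : finrank K (P ⊓ Q : Submodule K V) = 1 := hmeet P hPS Q hQS'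
    rw [hT.disjoint P hP Q hQ (fun e => hPS' (e ▸ hQS')), finrank_bot] at h1
    omega

end SwitchingSets

/-! ### The main theorem. -/

theorem theorem2 {K L V : Type*} [Field K] [Finite K] [Field L] [Algebra K L]
    [AddCommGroup V] [Module K V] (q : ℕ) (hq : Nat.card K = q)
    (hL : Module.finrank K L = 3) (hV : Module.finrank K V = 6)
    (X : Set (Submodule K V)) (hX : IsAndreHyperRegulus L X) :
    IsDisjointPlaneFamily X ∧
    ∃ Y Z : Set (Submodule K V), Y ≠ Z ∧
      (∀ T : Set (Submodule K V), IsSwitchingSet X T ↔ T = Y ∨ T = Z) ∧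
      (∀ P ∈ Y, ∀ Q ∈ Z, MeetInPoint P Q) ∧
      {P : Submodule K V | IsPlane P ∧ ∀ Q ∈ X, P ⊓ Q ≠ ⊥} = Y ∪ Z ∧
      {P : Submodule K V | IsPlane P ∧ ∀ Q ∈ X, MeetInPoint P Q} = Y ∪ Z ∧
      {P : Submodule K V | IsPlane P ∧ ∀ Q ∈ X, MeetInPoint P Q}.ncard =
        2 * (q ^ 2 + q + 1) := by
  have : FiniteDimensional K L := FiniteDimensional.of_finrank_pos (by omega)
  have : Finite L := Module.finite_of_finite K
  obtain ⟨ψ, rfl⟩ := hX.exists_eq_twistedFamily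
  obtain ⟨σ, τ, hσ, hτ, hστ, hall⟩ := exists_galois_eq_or_eq_or_eq hL
  have hfam := twistedFamily_isDisjointPlaneFamily hL ψ
  have hmeet := twistedFamily_meetInPoint hL ψ hστ
  have hdisj : Disjoint (twistedFamily ψ σ) (twistedFamily ψ τ) := by
    rw [Set.disjoint_left]
    intro P hP hP'
    -- A common plane would meet itself in a single point, though its vector dimension is 3.
    have h1 : finrank K (P ⊓ P : Submodule K V) = 1 := hmeet P hP P hP'
    have h2 : finrank K P = 3 := (hfam σ).isPlane P hP
    rw [inf_idem] at h1
    omega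
  have hne : (twistedFamily ψ σ).Nonempty :=
    Set.nonempty_of_ncard_ne_zero (by rw [(hfam σ).ncard_eq]; omega)
  have hplane (P : Submodule K V) (hP : P ∈ twistedFamily ψ σ ∪ twistedFamily ψ τ) :
      IsPlane P ∧ ∀ Q ∈ twistedFamily ψ 1, MeetInPoint P Q := by
    rcases hP with hP | hP
    · exact ⟨(hfam σ).isPlane P hP, twistedFamily_meetInPoint hL ψ hσ P hP⟩
    · exact ⟨(hfam τ).isPlane P hP, twistedFamily_meetInPoint hL ψ hτ P hP⟩
  have hne_bot {P Q : Submodule K V} (h : MeetInPoint P Q) : P ⊓ Q ≠ ⊥ := by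
    intro h0
    have h1 : finrank K (P ⊓ Q : Submodule K V) = 1 := h
    rw [h0, finrank_bot] at h1
    omega
  have hmem (P : Submodule K V) (hP : IsPlane P) (h : ∀ Q ∈ twistedFamily ψ 1, P ⊓ Q ≠ ⊥) :
      P ∈ twistedFamily ψ σ ∪ twistedFamily ψ τ := by
    obtain ⟨ρ, hρ, hPρ⟩ := exists_mem_twistedFamily hL ψ hP h
    rcases hall ρ hρ with rfl | rfl
    · exact Or.inl hPρ
    · exact Or.inr hPρ
  have hpoint : {P : Submodule K V | IsPlane P ∧ ∀ Q ∈ twistedFamily ψ 1, MeetInPoint P Q} =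
      twistedFamily ψ σ ∪ twistedFamily ψ τ :=
    Set.Subset.antisymm (fun P hP => hmem P hP.1 fun Q hQ => hne_bot (hP.2 Q hQ)) hplane
  refine ⟨hfam 1, twistedFamily ψ σ, twistedFamily ψ τ, fun h => ?_, fun T => ⟨fun hT => ?_, ?_⟩,
    hmeet, ?_, hpoint, ?_⟩
  · rw [← h] at hdisj
    exact hne.ne_empty (disjoint_self.mp hdisj)
  · exact (hfam σ).eq_or_eq_of_subset_union (hfam τ) hT.family hmeet fun P hP =>
      hmem P (hT.family.isPlane P hP) fun Q hQ => hne_bot (hT.meet P hP Q hQ)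
  · rintro (rfl | rfl)
    · exact ⟨hfam σ, twistedFamily_meetInPoint hL ψ hσ⟩
    · exact ⟨hfam τ, twistedFamily_meetInPoint hL ψ hτ⟩
  · exact Set.Subset.antisymm (fun P hP => hmem P hP.1 hP.2) fun P hP =>
      ⟨(hplane P hP).1, fun Q hQ => hne_bot ((hplane P hP).2 Q hQ)⟩
  · have hfin (ρ : Gal(L/K)) : (twistedFamily ψ ρ).Finite :=
      Set.finite_of_ncard_ne_zero (by rw [(hfam ρ).ncard_eq]; omega)
    rw [hpoint, Set.ncard_union_eq hdisj (hfin σ) (hfin τ), (hfam σ).ncard_eq, (hfam τ).ncard_eq,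
      hq]
    ring
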